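/- Let $(\mathsf Z,\mathscr Z)$ be a measurable space equipped with a preorder $\le$, let $P$ be a stochastic kernel on $\mathsf Z$ with $n$-step kernels $P^n$ ($P^0$ is the identity kernel), let $\beta\in(0,1)$, and let $r,c:\mathsf Z\to\mathbb R$ be measurable. Let $(Z_t)_{t\ge 0}$ be a time-homogeneous Markov process with kernel $P$ relative to a filtration $(\mathscr F_t)_{t\ge0}$, with $\mathbb P_z$, $\mathbb E_z$ denoting probability and expectation when $Z_0=z$, and let $\mathscr M$ be the set of almost surely finite $(\mathscr F_t)$-stopping times. Define $$v^*(z)=\sup_{\tau\in\mathscr M}\mathbb E_z\Big\{\sum_{t=0}^{\tau-1}\beta^t c(Z_t)+\beta^\tau r(Z_\tau)\Big\},\qquad \psi^*(z)=c(z)+\beta\int v^*(z')\,P(z,dz').$$ Assume (drift assumption) that there are a measurable $g:\mathsf Z\to[0,\infty)$, $n\in\{0,1,2,\dots\}$ and $m,d\ge 0$ with $\beta m<1$ such that for all $z\in\mathsf Z$ $$\max\Big\{\int|r|\,dP^n(z,\cdot),\int|c|\,dP^n(z,\cdot)\Big\}\le g(z),\qquad \int g\,dP(z,\cdot)\le m\,g(z)+d,$$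 and that $\int|r|\,dP^t(z,\cdot)$ and $\int|c|\,dP^t(z,\cdot)$ are finite for all $z$ and $1\le t\le n-1$. Let $m',d'>0$ satisfy $m+2m'>1$, $\beta(m+2m')<1$ and $d'\ge d/(m+2m'-1)$, put $$\ell(z)=m'\Big(\sum_{t=1}^{n-1}\int|r|\,dP^t(z,\cdot)+\sum_{t=0}^{n-1}\int|c|\,dP^t(z,\cdot)\Big)+g(z)+d',$$ and let $b_\ell\mathsf Z$ be the set of measurable $f:\mathsf Z\to\mathbb R$ with $\sup_z|f(z)|/\ell(z)<\infty$. Then $v^*$ and $\psi^*$ are well defined and finite (for every $z$ the payoff of each $\tau\in\mathscr M$ is $\mathbb P_z$-integrable, these expectations are bounded above over $\tau\in\mathscr M$, and $v^*$ is $P(z,\cdot)$-integrable), and the following holds, where increasing and decreasing are meant in the weak sense. Suppose that $c$ is increasing (resp. decreasing) and that $z\mapsto\int\max\{r(z'),\psi(z')\}\,P(z,dz')$ is increasing (resp. decreasing) for every increasing (resp. decreasing) $\psi\in b_\ell\mathsf Z$. Then $\psi^*$ is increasing (resp. decreasing). If in addition $r$ is increasing (resp. decreasing), then $v^*$ is increasing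 (resp. decreasing). -/

import Mathlib

open MeasureTheory ProbabilityTheory

namespace OptStop

/-- `(X t)` is a time-homogeneous Markov process with transition kernel `P` relative to the
filtration `F`; `Pr z` is the probability under which the process starts at `z`
(the starting condition is on the law of `X 0`, as `{z}` need not be measurable). -/
structure IsMarkovFamily {Ω Z : Type*} {mΩ : MeasurableSpace Ω} [MeasurableSpace Z]
    (P : Kernel Z Z) (F : Filtration ℕ mΩ) (Pr : Z → Measure Ω) (X : ℕ → Ω → Z) : Prop where
  isProbabilityMeasure : ∀ z, IsProbabilityMeasure (Pr z)
  adapted : ∀ t, Measurable[F t] (X t)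
  initial : ∀ z, (Pr z).map (X 0) = Measure.dirac z
  markov : ∀ (z : Z) (t : ℕ) (A : Set Ω), MeasurableSet[F t] A →
    ∀ B : Set Z, MeasurableSet B →
      Pr z (A ∩ X (t + 1) ⁻¹' B) = ∫⁻ ω in A, P (X t ω) B ∂(Pr z)

/-- The stopping times that are almost surely finite, from every starting point. -/
def finiteStoppingTimes {Ω Z : Type*} {mΩ : MeasurableSpace Ω}
    (F : Filtration ℕ mΩ) (Pr : Z → Measure Ω) : Set (Ω → WithTop ℕ) :=
  {τ | IsStoppingTime F τ ∧ ∀ z, ∀ᵐ ω ∂(Pr z), τ ω ≠ ⊤}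

/-- The discounted payoff `∑_{t < τ} β ^ t c(X_t) + β ^ τ r(X_τ)`. On the null event `τ = ⊤`
the value is irrelevant. -/
noncomputable def payoff {Ω Z : Type*} (β : ℝ) (r c : Z → ℝ) (X : ℕ → Ω → Z)
    (τ : Ω → WithTop ℕ) (ω : Ω) : ℝ :=
  ∑ t ∈ Finset.range ((τ ω).untopD 0), β ^ t * c (X t ω)
    + β ^ ((τ ω).untopD 0) * r (X ((τ ω).untopD 0) ω)

/-- The value function `v*`. -/
noncomputable def value {Ω Z : Type*} {mΩ : MeasurableSpace Ω} (β : ℝ) (r c : Z → ℝ)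
    (F : Filtration ℕ mΩ) (Pr : Z → Measure Ω) (X : ℕ → Ω → Z) (z : Z) : ℝ :=
  ⨆ τ : finiteStoppingTimes F Pr, ∫ ω, payoff β r c X τ ω ∂(Pr z)

/-- The continuation value function `ψ*(z) = c(z) + β ∫ v*(z') P(z, dz')`. -/
noncomputable def contValue {Ω Z : Type*} {mΩ : MeasurableSpace Ω} [MeasurableSpace Z]
    (P : Kernel Z Z) (β : ℝ) (r c : Z → ℝ)
    (F : Filtration ℕ mΩ) (Pr : Z → Measure Ω) (X : ℕ → Ω → Z) (z : Z) : ℝ :=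
  c z + β * ∫ z', value β r c F Pr X z' ∂(P z)

/-- The drift assumption, with witnesses `g`, `n`, `m`, `d`; `P ^ n` is the `n`-step kernel.
The integrals of nonnegative functions are taken in `[0, ∞]`, so that the inequalities
include finiteness. -/
structure DriftCondition {Z : Type*} [MeasurableSpace Z] (P : Kernel Z Z) (β : ℝ)
    (r c g : Z → ℝ) (n : ℕ) (m d : ℝ) : Prop where
  measurable_g : Measurable g
  g_nonneg : ∀ z, 0 ≤ g z
  m_nonneg : 0 ≤ m
  d_nonneg : 0 ≤ d
  discount : β * m < 1
  bound_r : ∀ z, ∫⁻ z', ENNReal.ofReal |r z'| ∂((P ^ n) z) ≤ ENNReal.ofReal (g z)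
  bound_c : ∀ z, ∫⁻ z', ENNReal.ofReal |c z'| ∂((P ^ n) z) ≤ ENNReal.ofReal (g z)
  drift : ∀ z, ∫⁻ z', ENNReal.ofReal (g z') ∂(P z) ≤ ENNReal.ofReal (m * g z + d)

/-- The weight function `ℓ`. -/
noncomputable def weight {Z : Type*} [MeasurableSpace Z] (P : Kernel Z Z)
    (r c g : Z → ℝ) (n : ℕ) (m' d' : ℝ) (z : Z) : ℝ :=
  m' * (∑ t ∈ Finset.Ico 1 n, ∫ z', |r z'| ∂((P ^ t) z)
      + ∑ t ∈ Finset.range n, ∫ z', |c z'| ∂((P ^ t) z)) + g z + d'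

/-- The measurable functions with finite `κ`-weighted supremum norm. -/
def weightedBounded {Z : Type*} [MeasurableSpace Z] (κ : Z → ℝ) : Set (Z → ℝ) :=
  {f | Measurable f ∧ BddAbove (Set.range fun z => |f z| / κ z)}

end OptStop

/-! Write `a = m + 2 * m'` and `Q φ = c + β ∫ max(r, φ) dP`. The weight `ℓ` is built so that `∫ ℓ dP
≤ a ℓ`, while `|c|` and `∫ |r| dP` are at most a multiple of `ℓ`
(`DriftCondition.lintegral_weight_le`, `DriftCondition.exists_weight_bound`). Since `β a < 1`, `Q`
contracts the `ℓ`-weighted distance, and its iterates from `0` converge pointwise to a fixed point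
`ψ` with `|ψ| ≤ B ℓ` (`exists_bellman_solution`). By hypothesis `Q` preserves monotonicity on `b_ℓ
Z`, so every iterate is monotone, and so is the limit `ψ`.

It remains to identify `ψ` with `ψ*`. The drift makes the discounted sums of `|r|`, `|c|` and `|ψ|`
along a path integrable, which dominates all payoffs at once. With exit reward `max(r, ψ)`, the
expected payoff of `τ ∧ N` starts at `max(r, ψ)(z)` and never increases with `N`; it stays constant
when `τ` is the first visit to `{ψ ≤ r}`. The first fact gives `v* ≤ max(r, ψ)`. The second, with
the visit truncated at `N` to keep the time finite, gives the converse up to an error that vanishes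
as `N → ∞` (`IsMarkovFamily.value_eq`). Hence `ψ* = Q ψ = ψ` and `v* = max(r, ψ)`.

The contraction is run on continuation values because `r` itself need not be bounded by a multiple
of `ℓ`; only its one-step expectation is. -/

namespace OptStop

open Filter Topology ENNReal

/-! ### Expectations along the Markov process. -/

section MarkovFamily

variable {Ω Z : Type*} {mΩ : MeasurableSpace Ω} [MeasurableSpace Z] {P : Kernel Z Z}
  {F : Filtration ℕ mΩ} {Pr : Z → Measure Ω} {X : ℕ → Ω → Z}

theorem IsMarkovFamily.measurable (hX : IsMarkovFamily P F Pr X) (t : ℕ) : Measurable (X t) :=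
  (hX.adapted t).mono (F.le t) le_rfl

/-- The Markov property as an identity of measures. -/
theorem IsMarkovFamily.map_restrict_succ (hX : IsMarkovFamily P F Pr X) (z : Z) (t : ℕ)
    {A : Set Ω} (hA : MeasurableSet[F t] A) :
    ((Pr z).restrict A).map (X (t + 1)) = (((Pr z).restrict A).map (X t)).bind P := by
  ext B hB
  rw [Measure.map_apply (hX.measurable _) hB,
    Measure.restrict_apply (hX.measurable _ hB), Set.inter_comm, hX.markov z t A hA B hB,
    Measure.bind_apply hB P.aemeasurable, lintegral_map (P.measurable_coe hB) (hX.measurable t)]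

theorem IsMarkovFamily.lintegral_succ (hX : IsMarkovFamily P F Pr X) (z : Z) (t : ℕ)
    {f : Z → ℝ≥0∞} (hf : Measurable f) :
    ∫⁻ ω, f (X (t + 1) ω) ∂(Pr z) = ∫⁻ ω, ∫⁻ y, f y ∂(P (X t ω)) ∂(Pr z) := by
  have h := hX.map_restrict_succ z t (A := Set.univ) MeasurableSet.univ
  rw [Measure.restrict_univ] at h
  rw [← lintegral_map hf (hX.measurable _), h, Measure.lintegral_bind P.aemeasurable hf.aemeasurable,
    lintegral_map hf.lintegral_kernel (hX.measurable t)]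

theorem IsMarkovFamily.setIntegral_succ (hX : IsMarkovFamily P F Pr X) (z : Z) (t : ℕ)
    {A : Set Ω} (hA : MeasurableSet[F t] A) {f : Z → ℝ} (hf : Measurable f)
    (hint : Integrable (fun ω => f (X (t + 1) ω)) (Pr z)) :
    ∫ ω in A, f (X (t + 1) ω) ∂(Pr z) = ∫ ω in A, ∫ y, f y ∂(P (X t ω)) ∂(Pr z) := by
  have h := hX.map_restrict_succ z t hA
  have hi : Integrable f (((Pr z).restrict A).map (X (t + 1))) :=
    (integrable_map_measure hf.aestronglyMeasurable (hX.measurable _).aemeasurable).2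
      hint.integrableOn
  rw [← integral_map (hX.measurable _).aemeasurable hf.aestronglyMeasurable]
  rw [h, Measure.comp_eq_comp_const_apply] at hi ⊢
  rw [Kernel.integral_comp hi, Kernel.const_apply,
    integral_map (hX.measurable t).aemeasurable
      hf.stronglyMeasurable.integral_kernel.aestronglyMeasurable]

/-- Substitutes for `X 0 = z` almost surely, which may fail to make sense as a measurable event:
only level sets of measurable functions are used. -/
theorem IsMarkovFamily.ae_apply_zero (hX : IsMarkovFamily P F Pr X) (z : Z) {α : Type*}
    [MeasurableSpace α] [MeasurableSingletonClass α] {f : Z → α} (hf : Measurable f) :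
    ∀ᵐ ω ∂(Pr z), f (X 0 ω) = f z := by
  have hs : MeasurableSet {y | f y = f z} := hf (measurableSet_singleton _)
  refine ae_of_ae_map (p := fun y => f y = f z) (hX.measurable 0).aemeasurable ?_
  rw [hX.initial z, ae_dirac_iff hs]

variable {β a : ℝ} {ℓ : Z → ℝ}

theorem IsMarkovFamily.lintegral_weight_le (hX : IsMarkovFamily P F Pr X) (ha : 0 ≤ a)
    (hℓ : Measurable ℓ)
    (hP : ∀ z, ∫⁻ y, ENNReal.ofReal (ℓ y) ∂(P z) ≤ ENNReal.ofReal (a * ℓ z)) (z : Z) (t : ℕ) :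
    ∫⁻ ω, ENNReal.ofReal (ℓ (X t ω)) ∂(Pr z) ≤ ENNReal.ofReal (a ^ t * ℓ z) := by
  have := hX.isProbabilityMeasure z
  induction t with
  | zero =>
    rw [lintegral_congr_ae (g := fun _ => ENNReal.ofReal (ℓ z))
      ((hX.ae_apply_zero z hℓ).mono fun ω h => by simp only [h])]
    simp
  | succ t ih =>
    rw [hX.lintegral_succ z t (f := fun y => ENNReal.ofReal (ℓ y)) (by fun_prop)]
    calc ∫⁻ ω, ∫⁻ y, ENNReal.ofReal (ℓ y) ∂(P (X t ω)) ∂(Pr z)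
        ≤ ∫⁻ ω, ENNReal.ofReal a * ENNReal.ofReal (ℓ (X t ω)) ∂(Pr z) :=
          lintegral_mono fun ω => (hP _).trans_eq (ENNReal.ofReal_mul ha)
      _ = ENNReal.ofReal a * ∫⁻ ω, ENNReal.ofReal (ℓ (X t ω)) ∂(Pr z) :=
          lintegral_const_mul _ (hℓ.comp (hX.measurable t)).ennreal_ofReal
      _ ≤ ENNReal.ofReal a * ENNReal.ofReal (a ^ t * ℓ z) := by gcongr
      _ = ENNReal.ofReal (a ^ (t + 1) * ℓ z) := by
          rw [← ENNReal.ofReal_mul ha]; ring_nf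

/-- One transition is spent on passing from `f` to `ℓ`, hence time `t + 1` on the left and `a ^ t`
on the right. -/
theorem IsMarkovFamily.lintegral_abs_succ_le (hX : IsMarkovFamily P F Pr X)
    (ha : 0 ≤ a) (hℓ : Measurable ℓ)
    (hP : ∀ z, ∫⁻ y, ENNReal.ofReal (ℓ y) ∂(P z) ≤ ENNReal.ofReal (a * ℓ z))
    {f : Z → ℝ} (hf : Measurable f) {K : ℝ} (hK : 0 ≤ K)
    (hfK : ∀ z, ∫⁻ y, ENNReal.ofReal |f y| ∂(P z) ≤ ENNReal.ofReal (K * ℓ z)) (z : Z) (t : ℕ) :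
    ∫⁻ ω, ENNReal.ofReal |f (X (t + 1) ω)| ∂(Pr z) ≤ ENNReal.ofReal (K * (a ^ t * ℓ z)) := by
  rw [hX.lintegral_succ z t (f := fun y => ENNReal.ofReal |f y|) (by fun_prop)]
  calc ∫⁻ ω, ∫⁻ y, ENNReal.ofReal |f y| ∂(P (X t ω)) ∂(Pr z)
      ≤ ∫⁻ ω, ENNReal.ofReal K * ENNReal.ofReal (ℓ (X t ω)) ∂(Pr z) :=
        lintegral_mono fun ω => (hfK _).trans_eq (ENNReal.ofReal_mul hK)
    _ = ENNReal.ofReal K * ∫⁻ ω, ENNReal.ofReal (ℓ (X t ω)) ∂(Pr z) :=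
        lintegral_const_mul _ (hℓ.comp (hX.measurable t)).ennreal_ofReal
    _ ≤ ENNReal.ofReal K * ENNReal.ofReal (a ^ t * ℓ z) := by
        gcongr
        exact hX.lintegral_weight_le ha hℓ hP z t
    _ = ENNReal.ofReal (K * (a ^ t * ℓ z)) := (ENNReal.ofReal_mul hK).symm

/-- The total expected discounted size of a function whose one-step expectation is dominated by
the weight is finite. -/
theorem IsMarkovFamily.lintegral_tsum_ne_top (hX : IsMarkovFamily P F Pr X) (hβ : 0 ≤ β)
    (ha : 0 ≤ a) (hβa : β * a < 1) (hℓ : Measurable ℓ)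
    (hP : ∀ z, ∫⁻ y, ENNReal.ofReal (ℓ y) ∂(P z) ≤ ENNReal.ofReal (a * ℓ z))
    {f : Z → ℝ} (hf : Measurable f) {K : ℝ} (hK : 0 ≤ K)
    (hfK : ∀ z, ∫⁻ y, ENNReal.ofReal |f y| ∂(P z) ≤ ENNReal.ofReal (K * ℓ z)) (z : Z) :
    ∫⁻ ω, ∑' t, ENNReal.ofReal (β ^ t * |f (X t ω)|) ∂(Pr z) ≠ ⊤ := by
  have := hX.isProbabilityMeasure z
  have hm : ∀ t, Measurable fun ω => |f (X t ω)| := fun t =>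
    continuous_abs.measurable.comp (hf.comp (hX.measurable t))
  have heq : ∀ t, ∫⁻ ω, ENNReal.ofReal (β ^ t * |f (X t ω)|) ∂(Pr z)
      = ENNReal.ofReal (β ^ t) * ∫⁻ ω, ENNReal.ofReal |f (X t ω)| ∂(Pr z) := fun t => by
    rw [← lintegral_const_mul _ (hm t).ennreal_ofReal]
    exact lintegral_congr fun ω => ENNReal.ofReal_mul (pow_nonneg hβ t)
  -- Time `0` is split off: `|f|` has no pointwise bound by `ℓ`, but its initial expectation is just
  -- `|f z|`. The rest is dominated by a geometric series of ratio `β * a`.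
  have htsum : ∫⁻ ω, ∑' t, ENNReal.ofReal (β ^ t * |f (X t ω)|) ∂(Pr z)
      = ENNReal.ofReal (β ^ 0) * ∫⁻ ω, ENNReal.ofReal |f (X 0 ω)| ∂(Pr z)
        + ∑' t, ENNReal.ofReal (β ^ (t + 1)) *
          ∫⁻ ω, ENNReal.ofReal |f (X (t + 1) ω)| ∂(Pr z) := by
    rw [lintegral_tsum fun t => ((hm t).const_mul (β ^ t)).ennreal_ofReal.aemeasurable,
      tsum_congr heq, tsum_eq_zero_add' ENNReal.summable]
  rw [htsum]
  refine ENNReal.add_ne_top.2 ⟨?_, ?_⟩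
  · rw [lintegral_congr_ae (g := fun _ => ENNReal.ofReal |f z|)
      ((hX.ae_apply_zero z hf).mono fun ω h => by simp only [h])]
    simp
  · have hle : ∀ t : ℕ, ENNReal.ofReal (β ^ (t + 1)) *
        ∫⁻ ω, ENNReal.ofReal |f (X (t + 1) ω)| ∂(Pr z)
          ≤ ENNReal.ofReal (β * K * (ℓ z) * (β * a) ^ t) := by
      intro t
      refine (mul_le_mul_right (hX.lintegral_abs_succ_le ha hℓ hP hf hK hfK z t) _).trans_eq ?_
      rw [← ENNReal.ofReal_mul (pow_nonneg hβ _)]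
      congr 1
      ring
    have hs : Summable fun t => β * K * (ℓ z) * (β * a) ^ t :=
      (summable_geometric_of_lt_one (mul_nonneg hβ ha) hβa).mul_left _
    exact ne_top_of_le_ne_top hs.tsum_ofReal_ne_top (ENNReal.tsum_le_tsum hle)

end MarkovFamily

/-! ### Pathwise bounds and increments of the payoff. -/

section PathwisePayoff

variable {Ω Z : Type*} {X : ℕ → Ω → Z} {β : ℝ} {r c f : Z → ℝ}

/-- The total discounted size of `f` along a path. -/
noncomputable def totalSize (β : ℝ) (f : Z → ℝ) (X : ℕ → Ω → Z) (ω : Ω) : ℝ≥0∞ :=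
  ∑' t, ENNReal.ofReal (β ^ t * |f (X t ω)|)

theorem sum_le_toReal_totalSize (hβ : 0 ≤ β) {ω : Ω} (h : totalSize β f X ω ≠ ⊤)
    (s : Finset ℕ) : ∑ t ∈ s, β ^ t * |f (X t ω)| ≤ (totalSize β f X ω).toReal := by
  rw [← ENNReal.ofReal_le_iff_le_toReal h, ENNReal.ofReal_sum_of_nonneg fun t _ => by positivity]
  exact ENNReal.sum_le_tsum s

theorem term_le_toReal_totalSize (hβ : 0 ≤ β) {ω : Ω} (h : totalSize β f X ω ≠ ⊤) (t : ℕ) :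
    β ^ t * |f (X t ω)| ≤ (totalSize β f X ω).toReal := by
  simpa using sum_le_toReal_totalSize hβ h {t}

/-- The bound does not depend on `τ`, so it serves integrability, boundedness of the supremum and
dominated convergence alike. -/
theorem abs_payoff_le (hβ : 0 ≤ β) (τ : Ω → WithTop ℕ) {ω : Ω} (hr : totalSize β r X ω ≠ ⊤)
    (hc : totalSize β c X ω ≠ ⊤) :
    |payoff β r c X τ ω| ≤ (totalSize β c X ω).toReal + (totalSize β r X ω).toReal := by
  refine (abs_add_le _ _).trans (add_le_add ?_ ?_)
  · refine (Finset.abs_sum_le_sum_abs _ _).trans ?_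
    simp_rw [abs_mul, abs_pow, abs_of_nonneg hβ]
    exact sum_le_toReal_totalSize hβ hc _
  · rw [abs_mul, abs_pow, abs_of_nonneg hβ]
    exact term_le_toReal_totalSize hβ hr _

theorem untopD_natCast (k d : ℕ) : ((k : ℕ) : WithTop ℕ).untopD d = k := rfl

/-- The increment lives on `{N < τ}`, an event known at time `N`, so the Markov property can be
applied to it. -/
theorem payoff_min_succ (β : ℝ) (r c : Z → ℝ) (X : ℕ → Ω → Z) (τ : Ω → WithTop ℕ) (N : ℕ)
    (ω : Ω) :
    payoff β r c X (fun ω => min (τ ω) ((N + 1 : ℕ) : WithTop ℕ)) ω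
      = payoff β r c X (fun ω => min (τ ω) (N : WithTop ℕ)) ω
        + {ω | (N : WithTop ℕ) < τ ω}.indicator (fun ω =>
            β ^ N * (c (X N ω) + β * r (X (N + 1) ω) - r (X N ω))) ω := by
  by_cases h : (N : WithTop ℕ) < τ ω
  · have h1 : min (τ ω) ((N + 1 : ℕ) : WithTop ℕ) = ((N + 1 : ℕ) : WithTop ℕ) :=
      min_eq_right (by
        cases hω : τ ω with
        | top => exact le_top
        | coe a =>
          rw [hω] at h
          exact Nat.cast_le.2 (Nat.succ_le_of_lt (Nat.cast_lt.1 h)))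
    rw [Set.indicator_of_mem (by exact h)]
    simp only [payoff, h1, min_eq_right h.le, untopD_natCast, Finset.sum_range_succ]
    ring
  · have h' : τ ω ≤ N := not_lt.1 h
    have h1 : min (τ ω) ((N + 1 : ℕ) : WithTop ℕ) = τ ω :=
      min_eq_left (h'.trans (by exact_mod_cast Nat.le_succ N))
    rw [Set.indicator_of_notMem (by exact h)]
    simp only [payoff, h1, min_eq_left h', add_zero]

end PathwisePayoff

/-! ### Integrability of payoffs and optional stopping. -/

section Payoff

variable {Ω Z : Type*} {mΩ : MeasurableSpace Ω} [MeasurableSpace Z] {P : Kernel Z Z}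
  {F : Filtration ℕ mΩ} {Pr : Z → Measure Ω} {X : ℕ → Ω → Z} {β : ℝ} {r c f ψ : Z → ℝ}
  {τ : Ω → WithTop ℕ} {μ : Measure Ω}

theorem measurable_totalSize (hX : ∀ t, Measurable (X t)) (hf : Measurable f) :
    Measurable (totalSize β f X) :=
  Measurable.tsum fun t =>
    ((continuous_abs.measurable.comp (hf.comp (hX t))).const_mul _).ennreal_ofReal

theorem ae_totalSize_ne_top (hX : ∀ t, Measurable (X t)) (hf : Measurable f)
    (h : ∫⁻ ω, totalSize β f X ω ∂μ ≠ ⊤) : ∀ᵐ ω ∂μ, totalSize β f X ω ≠ ⊤ :=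
  (ae_lt_top (measurable_totalSize hX hf) h).mono fun _ h => h.ne

theorem integrable_totalSize (hX : ∀ t, Measurable (X t)) (hf : Measurable f)
    (h : ∫⁻ ω, totalSize β f X ω ∂μ ≠ ⊤) : Integrable (fun ω => (totalSize β f X ω).toReal) μ :=
  integrable_toReal_of_lintegral_ne_top (measurable_totalSize hX hf).aemeasurable h

theorem integrable_comp_of_totalSize (hβ : 0 < β) (hX : ∀ t, Measurable (X t)) (hf : Measurable f)
    (h : ∫⁻ ω, totalSize β f X ω ∂μ ≠ ⊤) (t : ℕ) : Integrable (fun ω => f (X t ω)) μ := by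
  refine ((integrable_totalSize hX hf h).const_mul ((β ^ t)⁻¹)).mono'
    (hf.comp (hX t)).aestronglyMeasurable ?_
  filter_upwards [ae_totalSize_ne_top hX hf h] with ω hω
  rw [Real.norm_eq_abs, ← div_eq_inv_mul, le_div_iff₀ (by positivity), mul_comm]
  exact term_le_toReal_totalSize hβ.le hω t

theorem measurable_payoff (hX : ∀ t, Measurable (X t)) (hr : Measurable r) (hc : Measurable c)
    (hτ : IsStoppingTime F τ) : Measurable (payoff β r c X τ) := by
  have hN : Measurable fun ω => (τ ω).untopD 0 := by
    refine measurable_to_countable' fun k => ?_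
    have hk : ∀ i : ℕ, MeasurableSet {ω | τ ω = i} := fun i => F.le i _ (hτ.measurableSet_eq i)
    by_cases hk0 : k = 0
    -- The default value sends `τ = ⊤` to `0` as well, so this fibre is the complement of all the
    -- others.
    · have : (fun ω => (τ ω).untopD 0) ⁻¹' {k} = (⋃ i ∈ {i : ℕ | i ≠ 0}, {ω | τ ω = i})ᶜ := by
        ext ω
        cases h : τ ω with
        | top => simp [h, hk0]
        | coe a =>
          have : ∀ i : ℕ, ((a : ℕ) : WithTop ℕ) = i ↔ a = i := fun i => Nat.cast_inj
          simp only [Set.mem_preimage, Set.mem_singleton_iff, Set.mem_compl_iff, Set.mem_iUnion,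
            Set.mem_ofPred_eq, h, hk0, WithTop.untopD_coe, exists_prop, not_exists, not_and]
          exact ⟨fun ha i hi hai => hi ((this i).1 hai ▸ ha), fun ha => by
            by_contra h0
            exact ha a h0 rfl⟩
      rw [this]
      exact (MeasurableSet.biUnion (Set.to_countable _) fun i _ => hk i).compl
    · have : (fun ω => (τ ω).untopD 0) ⁻¹' {k} = {ω | τ ω = k} := by
        ext ω
        cases h : τ ω with
        | top => simp [h, Ne.symm hk0]
        | coe a =>
          simp only [Set.mem_preimage, Set.mem_singleton_iff, Set.mem_ofPred_eq, h,
            WithTop.untopD_coe]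
          exact (Nat.cast_inj (R := WithTop ℕ) (m := a) (n := k)).symm
      rw [this]
      exact hk k
  have hm : Measurable fun p : Ω × ℕ =>
      ∑ t ∈ Finset.range p.2, β ^ t * c (X t p.1) + β ^ p.2 * r (X p.2 p.1) := by
    refine measurable_from_prod_countable_left fun k => ?_
    exact (Finset.measurable_fun_sum (Finset.range k) fun t _ =>
      (hc.comp (hX t)).const_mul (β ^ t)).add ((hr.comp (hX k)).const_mul (β ^ k))
  exact hm.comp (measurable_id.prodMk hN)

theorem integrable_payoff (hβ : 0 ≤ β) (hX : ∀ t, Measurable (X t)) (hr : Measurable r)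
    (hc : Measurable c) (hτ : IsStoppingTime F τ) (hrS : ∫⁻ ω, totalSize β r X ω ∂μ ≠ ⊤)
    (hcS : ∫⁻ ω, totalSize β c X ω ∂μ ≠ ⊤) : Integrable (payoff β r c X τ) μ := by
  refine ((integrable_totalSize hX hc hcS).add (integrable_totalSize hX hr hrS)).mono'
    (measurable_payoff hX hr hc hτ).aestronglyMeasurable ?_
  filter_upwards [ae_totalSize_ne_top hX hc hcS, ae_totalSize_ne_top hX hr hrS] with ω h1 h2
  exact abs_payoff_le hβ τ h2 h1

/-- Optional stopping: truncating one step later changes the expected payoff by the expected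
one-step drift on the event that stopping has not occurred. -/
theorem IsMarkovFamily.integral_payoff_min_succ (hX : IsMarkovFamily P F Pr X) (hβ : 0 < β)
    (hr : Measurable r) (hc : Measurable c) (hτ : IsStoppingTime F τ) {z : Z}
    (hrS : ∫⁻ ω, totalSize β r X ω ∂(Pr z) ≠ ⊤) (hcS : ∫⁻ ω, totalSize β c X ω ∂(Pr z) ≠ ⊤)
    (hψ : ∀ y, ψ y = c y + β * ∫ y', r y' ∂(P y))
    (hψi : ∀ t, Integrable (fun ω => ψ (X t ω)) (Pr z)) (N : ℕ) :
    ∫ ω, payoff β r c X (fun ω => min (τ ω) ((N + 1 : ℕ) : WithTop ℕ)) ω ∂(Pr z)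
      = ∫ ω, payoff β r c X (fun ω => min (τ ω) (N : WithTop ℕ)) ω ∂(Pr z)
        + β ^ N * ∫ ω in {ω | (N : WithTop ℕ) < τ ω}, (ψ (X N ω) - r (X N ω)) ∂(Pr z) := by
  have hXm := hX.measurable
  have hA : MeasurableSet[F N] {ω | (N : WithTop ℕ) < τ ω} := hτ.measurableSet_gt N
  have hA' := F.le N _ hA
  have hci := integrable_comp_of_totalSize hβ hXm hc hcS
  have hri := integrable_comp_of_totalSize hβ hXm hr hrS
  -- This function is `ψ (X N) - c (X N)`.
  have hPi : Integrable (fun ω => β * ∫ y', r y' ∂(P (X N ω))) (Pr z) := by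
    refine ((hψi N).sub (hci N)).congr (ae_of_all _ fun ω => ?_)
    simp [hψ (X N ω)]
  have hDi : Integrable (fun ω => β ^ N * (c (X N ω) + β * r (X (N + 1) ω) - r (X N ω))) (Pr z) :=
    (((hci N).add ((hri (N + 1)).const_mul β)).sub (hri N)).const_mul _
  have hCi : Integrable (fun ω => c (X N ω) + β * r (X (N + 1) ω)) (Pr z) :=
    (hci N).add ((hri (N + 1)).const_mul β)
  have hmin : IsStoppingTime F fun ω => min (τ ω) (N : WithTop ℕ) := hτ.min_const N
  simp_rw [payoff_min_succ β r c X τ N]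
  rw [integral_add (integrable_payoff hβ.le hXm hr hc hmin hrS hcS)
    (hDi.indicator hA'), integral_indicator hA', integral_const_mul]
  congr 2
  rw [integral_sub hCi.integrableOn (hri N).integrableOn,
    integral_add (hci N).integrableOn ((hri (N + 1)).const_mul β).integrableOn,
    integral_const_mul, hX.setIntegral_succ z N hA hr (hri (N + 1)),
    integral_sub (hψi N).integrableOn (hri N).integrableOn]
  simp_rw [hψ]
  rw [integral_add (hci N).integrableOn hPi.integrableOn, integral_const_mul]

theorem IsMarkovFamily.integral_payoff_min_zero (hX : IsMarkovFamily P F Pr X)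
    (hr : Measurable r) (z : Z) :
    ∫ ω, payoff β r c X (fun ω => min (τ ω) ((0 : ℕ) : WithTop ℕ)) ω ∂(Pr z) = r z := by
  have := hX.isProbabilityMeasure z
  rw [integral_congr_ae (g := fun _ => r z)]
  · simp
  · filter_upwards [hX.ae_apply_zero z hr] with ω hω
    simp [payoff, hω]

end Payoff

/-! ### Verification: a Bellman solution determines the value function. -/

section Verification

variable {Ω Z : Type*} {mΩ : MeasurableSpace Ω} [MeasurableSpace Z] {P : Kernel Z Z}
  {F : Filtration ℕ mΩ} {Pr : Z → Measure Ω} {X : ℕ → Ω → Z} {β : ℝ} {r c f ψ : Z → ℝ}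
  {τ : Ω → WithTop ℕ} {μ : Measure Ω}

/-- These are the terms of a convergent series. They bound the cost of truncating at time `N`. -/
theorem tendsto_integral_discounted_abs (hβ : 0 ≤ β) (hX : ∀ t, Measurable (X t))
    (hf : Measurable f) (h : ∫⁻ ω, totalSize β f X ω ∂μ ≠ ⊤) :
    Tendsto (fun N => ∫ ω, β ^ N * |f (X N ω)| ∂μ) atTop (𝓝 0) := by
  have hm : ∀ t, Measurable fun ω => β ^ t * |f (X t ω)| := fun t =>
    (continuous_abs.measurable.comp (hf.comp (hX t))).const_mul _
  have h' : ∑' t, ∫⁻ ω, ENNReal.ofReal (β ^ t * |f (X t ω)|) ∂μ ≠ ⊤ := by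
    rwa [← lintegral_tsum fun t => (hm t).ennreal_ofReal.aemeasurable]
  have ht := (ENNReal.tendsto_toReal ENNReal.zero_ne_top).comp
    (ENNReal.tendsto_atTop_zero_of_tsum_ne_top h')
  refine ht.congr fun N => ?_
  rw [integral_eq_lintegral_of_nonneg_ae (ae_of_all _ fun ω => by positivity)
    (hm N).aestronglyMeasurable]
  rfl

theorem lintegral_totalSize_max_ne_top (hβ : 0 ≤ β) (hX : ∀ t, Measurable (X t))
    (hr : Measurable r) (hrS : ∫⁻ ω, totalSize β r X ω ∂μ ≠ ⊤)
    (hψS : ∫⁻ ω, totalSize β ψ X ω ∂μ ≠ ⊤) :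
    ∫⁻ ω, totalSize β (fun z => max (r z) (ψ z)) X ω ∂μ ≠ ⊤ := by
  refine ne_top_of_le_ne_top (ENNReal.add_ne_top.2 ⟨hrS, hψS⟩) ?_
  rw [← lintegral_add_left (measurable_totalSize hX hr)]
  refine lintegral_mono fun ω => ?_
  simp only [totalSize]
  rw [← ENNReal.tsum_add]
  refine ENNReal.tsum_le_tsum fun t => ?_
  rw [← ENNReal.ofReal_add (by positivity) (by positivity), ← mul_add]
  refine ENNReal.ofReal_le_ofReal (mul_le_mul_of_nonneg_left ?_ (by positivity))
  refine abs_max_le_max_abs_abs.trans (max_le ?_ ?_)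
  · linarith [abs_nonneg (ψ (X t ω))]
  · linarith [abs_nonneg (r (X t ω))]

theorem integral_payoff_le_of_totalSize (hβ : 0 ≤ β) (hX : ∀ t, Measurable (X t))
    (hr : Measurable r) (hc : Measurable c) (hrS : ∫⁻ ω, totalSize β r X ω ∂μ ≠ ⊤)
    (hcS : ∫⁻ ω, totalSize β c X ω ∂μ ≠ ⊤) (hτ : IsStoppingTime F τ) :
    ∫ ω, payoff β r c X τ ω ∂μ
      ≤ ∫ ω, ((totalSize β c X ω).toReal + (totalSize β r X ω).toReal) ∂μ := by
  refine integral_mono_ae (integrable_payoff hβ hX hr hc hτ hrS hcS)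
    ((integrable_totalSize hX hc hcS).add (integrable_totalSize hX hr hrS)) ?_
  filter_upwards [ae_totalSize_ne_top hX hc hcS, ae_totalSize_ne_top hX hr hrS] with ω h1 h2
  exact (le_abs_self _).trans (abs_payoff_le hβ τ h2 h1)

/-- A solution of the Bellman equation dominates the expected payoff of each stopping time. -/
theorem IsMarkovFamily.integral_payoff_le (hX : IsMarkovFamily P F Pr X) (hβ : 0 < β)
    (hr : Measurable r) (hc : Measurable c) (hψm : Measurable ψ) {z : Z}
    (hrS : ∫⁻ ω, totalSize β r X ω ∂(Pr z) ≠ ⊤) (hcS : ∫⁻ ω, totalSize β c X ω ∂(Pr z) ≠ ⊤)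
    (hψS : ∫⁻ ω, totalSize β ψ X ω ∂(Pr z) ≠ ⊤)
    (hψ : ∀ y, ψ y = c y + β * ∫ y', max (r y') (ψ y') ∂(P y))
    (hτ : IsStoppingTime F τ) (hτfin : ∀ᵐ ω ∂(Pr z), τ ω ≠ ⊤) :
    ∫ ω, payoff β r c X τ ω ∂(Pr z) ≤ max (r z) (ψ z) := by
  have hXm := hX.measurable
  have hvm : Measurable fun y => max (r y) (ψ y) := hr.max hψm
  have hvS := lintegral_totalSize_max_ne_top hβ.le hXm hr hrS hψS
  have hmin : ∀ N : ℕ, IsStoppingTime F fun ω => min (τ ω) (N : WithTop ℕ) := fun N =>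
    hτ.min_const N
  -- With exit reward `max(r, ψ)` the one-step drift is `ψ - max(r, ψ) ≤ 0`.
  have hN : ∀ N : ℕ, ∫ ω, payoff β (fun y => max (r y) (ψ y)) c X
      (fun ω => min (τ ω) (N : WithTop ℕ)) ω ∂(Pr z) ≤ max (r z) (ψ z) := by
    intro N
    induction N with
    | zero => exact (hX.integral_payoff_min_zero hvm z).le
    | succ N ih =>
      rw [hX.integral_payoff_min_succ hβ hvm hc hτ hvS hcS hψ
        (integrable_comp_of_totalSize hβ hXm hψm hψS)]
      have : ∫ ω in {ω | (N : WithTop ℕ) < τ ω},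
          (ψ (X N ω) - max (r (X N ω)) (ψ (X N ω))) ∂(Pr z) ≤ 0 :=
        integral_nonpos fun ω => sub_nonpos.2 (le_max_right _ _)
      nlinarith [mul_nonpos_of_nonneg_of_nonpos (pow_nonneg hβ.le N) this]
  have hlim : Tendsto (fun N : ℕ => ∫ ω, payoff β (fun y => max (r y) (ψ y)) c X
      (fun ω => min (τ ω) (N : WithTop ℕ)) ω ∂(Pr z)) atTop
      (𝓝 (∫ ω, payoff β (fun y => max (r y) (ψ y)) c X τ ω ∂(Pr z))) := by
    refine tendsto_integral_of_dominated_convergence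
      (fun ω => (totalSize β c X ω).toReal
        + (totalSize β (fun y => max (r y) (ψ y)) X ω).toReal)
      (fun N => (measurable_payoff hXm hvm hc (hmin N)).aestronglyMeasurable)
      ((integrable_totalSize hXm hc hcS).add (integrable_totalSize hXm hvm hvS)) ?_ ?_
    · intro N
      filter_upwards [ae_totalSize_ne_top hXm hc hcS, ae_totalSize_ne_top hXm hvm hvS]
        with ω h1 h2
      exact abs_payoff_le hβ.le _ h2 h1
    -- Almost sure finiteness enters here: `τ ∧ N` is eventually equal to `τ`.
    · filter_upwards [hτfin] with ω hω
      lift τ ω to ℕ using hω with k hk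
      refine tendsto_const_nhds.congr' ?_
      filter_upwards [eventually_ge_atTop k] with N hkN
      have : min (τ ω) (N : WithTop ℕ) = τ ω := min_eq_left (hk ▸ Nat.cast_le.2 hkN)
      simp only [payoff, this]
  refine le_trans ?_ (le_of_tendsto' hlim hN)
  refine integral_mono (integrable_payoff hβ.le hXm hr hc hτ hrS hcS)
    (integrable_payoff hβ.le hXm hvm hc hτ hvS hcS) fun ω => ?_
  exact add_le_add_right (mul_le_mul_of_nonneg_left (le_max_left _ _) (by positivity)) _

/-- Stopping at the first visit before time `N` to the set where stopping is optimal attains a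
solution of the Bellman equation up to a discounted error. -/
theorem IsMarkovFamily.le_integral_payoff_hitting (hX : IsMarkovFamily P F Pr X) (hβ : 0 < β)
    (hr : Measurable r) (hc : Measurable c) (hψm : Measurable ψ) {z : Z}
    (hrS : ∫⁻ ω, totalSize β r X ω ∂(Pr z) ≠ ⊤) (hcS : ∫⁻ ω, totalSize β c X ω ∂(Pr z) ≠ ⊤)
    (hψS : ∫⁻ ω, totalSize β ψ X ω ∂(Pr z) ≠ ⊤)
    (hψ : ∀ y, ψ y = c y + β * ∫ y', max (r y') (ψ y') ∂(P y)) (N : ℕ) :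
    max (r z) (ψ z) ≤ ∫ ω, payoff β r c X
        (fun ω => ((hittingBtwn X {y | ψ y ≤ r y} 0 N ω : ℕ) : WithTop ℕ)) ω ∂(Pr z)
      + ((∫ ω, β ^ N * |r (X N ω)| ∂(Pr z)) + ∫ ω, β ^ N * |ψ (X N ω)| ∂(Pr z)) := by
  have hXm := hX.measurable
  set σ : Ω → WithTop ℕ := fun ω => ((hittingBtwn X {y | ψ y ≤ r y} 0 N ω : ℕ) : WithTop ℕ)
  have hvm : Measurable fun y => max (r y) (ψ y) := hr.max hψm
  have hvS := lintegral_totalSize_max_ne_top hβ.le hXm hr hrS hψS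
  have hσ : IsStoppingTime F σ :=
    Adapted.isStoppingTime_hittingBtwn hX.adapted (measurableSet_le hψm hr)
  -- Before the hitting time `r < ψ`, so the drift `ψ - max(r, ψ)` vanishes there.
  have hk : ∀ k : ℕ, ∫ ω, payoff β (fun y => max (r y) (ψ y)) c X
      (fun ω => min (σ ω) (k : WithTop ℕ)) ω ∂(Pr z) = max (r z) (ψ z) := by
    intro k
    induction k with
    | zero => exact hX.integral_payoff_min_zero hvm z
    | succ k ih =>
      rw [hX.integral_payoff_min_succ hβ hvm hc hσ hvS hcS hψ
        (integrable_comp_of_totalSize hβ hXm hψm hψS), ih, setIntegral_eq_zero_of_forall_eq_zero]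
      · simp
      · intro ω hω
        have : ¬ ψ (X k ω) ≤ r (X k ω) :=
          notMem_of_lt_hittingBtwn (Nat.cast_lt.1 (show (k : WithTop ℕ) < _ from hω)) (Nat.zero_le k)
        rw [max_eq_right (not_le.1 this).le, sub_self]
  have hσN : ∀ ω, min (σ ω) (N : WithTop ℕ) = σ ω := fun ω =>
    min_eq_left (Nat.cast_le.2 (hittingBtwn_le ω))
  have hri := (integrable_comp_of_totalSize hβ hXm hr hrS N).abs.const_mul (β ^ N)
  have hψi := (integrable_comp_of_totalSize hβ hXm hψm hψS N).abs.const_mul (β ^ N)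
  have hpi := integrable_payoff hβ.le hXm hr hc hσ hrS hcS
  have hei : Integrable (fun ω => β ^ N * |r (X N ω)| + β ^ N * |ψ (X N ω)|) (Pr z) :=
    hri.add hψi
  rw [← hk N]
  simp_rw [hσN]
  rw [← integral_add hri hψi, ← integral_add hpi hei]
  refine integral_mono (integrable_payoff hβ.le hXm hvm hc hσ hvS hcS) (hpi.add hei)
    fun ω => ?_
  have hval : (σ ω).untopD 0 = hittingBtwn X {y | ψ y ≤ r y} 0 N ω := rfl
  simp only [payoff, hval]
  have hβN : 0 < β ^ N := by positivity
  -- `hittingBtwn` also returns `N` when no visit occurs, so `r = max(r, ψ)` at the stopped state is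
  -- guaranteed only when the time is below `N`. At `N` the error terms cover the gap.
  rcases (hittingBtwn_le (u := X) (s := {y | ψ y ≤ r y}) (n := 0) (m := N) ω).lt_or_eq
    with hlt | heq
  · have : ψ (X _ ω) ≤ r (X _ ω) := hittingBtwn_mem_set_of_hittingBtwn_lt hlt
    rw [max_eq_left this]
    have := mul_nonneg hβN.le (abs_nonneg (r (X N ω)))
    have := mul_nonneg hβN.le (abs_nonneg (ψ (X N ω)))
    linarith
  · rw [heq]
    have : max (r (X N ω)) (ψ (X N ω)) ≤ r (X N ω) + (|r (X N ω)| + |ψ (X N ω)|) :=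
      max_le (by linarith [abs_nonneg (r (X N ω)), abs_nonneg (ψ (X N ω))])
        (by linarith [neg_abs_le (r (X N ω)), le_abs_self (ψ (X N ω))])
    linarith [mul_le_mul_of_nonneg_left this hβN.le]

theorem bddAbove_integral_payoff (hβ : 0 ≤ β) (hX : ∀ t, Measurable (X t))
    (hr : Measurable r) (hc : Measurable c) {z : Z}
    (hrS : ∫⁻ ω, totalSize β r X ω ∂(Pr z) ≠ ⊤) (hcS : ∫⁻ ω, totalSize β c X ω ∂(Pr z) ≠ ⊤) :
    BddAbove (Set.range fun τ : finiteStoppingTimes F Pr =>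
      ∫ ω, payoff β r c X τ ω ∂(Pr z)) := by
  refine ⟨∫ ω, ((totalSize β c X ω).toReal + (totalSize β r X ω).toReal) ∂(Pr z), ?_⟩
  rintro _ ⟨τ, rfl⟩
  exact integral_payoff_le_of_totalSize hβ hX hr hc hrS hcS τ.2.1

/-- The value function is the maximum of the exit payoff and a solution of the Bellman
equation. -/
theorem IsMarkovFamily.value_eq (hX : IsMarkovFamily P F Pr X) (hβ : 0 < β)
    (hr : Measurable r) (hc : Measurable c) (hψm : Measurable ψ) {z : Z}
    (hrS : ∫⁻ ω, totalSize β r X ω ∂(Pr z) ≠ ⊤) (hcS : ∫⁻ ω, totalSize β c X ω ∂(Pr z) ≠ ⊤)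
    (hψS : ∫⁻ ω, totalSize β ψ X ω ∂(Pr z) ≠ ⊤)
    (hψ : ∀ y, ψ y = c y + β * ∫ y', max (r y') (ψ y') ∂(P y)) :
    value β r c F Pr X z = max (r z) (ψ z) := by
  have hXm := hX.measurable
  refine le_antisymm ?_ ?_
  · have : Nonempty (finiteStoppingTimes F Pr) :=
      ⟨⟨fun _ => ((0 : ℕ) : WithTop ℕ), isStoppingTime_const F 0,
        fun z => ae_of_all _ fun ω => WithTop.coe_ne_top⟩⟩
    exact ciSup_le fun τ =>
      hX.integral_payoff_le hβ hr hc hψm hrS hcS hψS hψ τ.2.1 (τ.2.2 z)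
  · have hlim := ((tendsto_integral_discounted_abs hβ.le hXm hr hrS).add
      (tendsto_integral_discounted_abs hβ.le hXm hψm hψS)).const_add (value β r c F Pr X z)
    rw [add_zero, add_zero] at hlim
    refine ge_of_tendsto' hlim fun N => ?_
    refine (hX.le_integral_payoff_hitting hβ hr hc hψm hrS hcS hψS hψ N).trans ?_
    refine add_le_add_left ?_ _
    exact le_ciSup (bddAbove_integral_payoff hβ.le hXm hr hc hrS hcS)
      (⟨_, Adapted.isStoppingTime_hittingBtwn hX.adapted (measurableSet_le hψm hr),
        fun z => ae_of_all _ fun ω => WithTop.coe_ne_top⟩ : finiteStoppingTimes F Pr)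

end Verification

/-! ### The Bellman operator as a weighted contraction. -/

section Bellman

variable {Z : Type*} [MeasurableSpace Z] {P : Kernel Z Z} {β a K : ℝ} {r c ℓ φ φ' : Z → ℝ}

/-- The Bellman operator on continuation values. -/
noncomputable def bellman (P : Kernel Z Z) (β : ℝ) (r c φ : Z → ℝ) (z : Z) : ℝ :=
  c z + β * ∫ z', max (r z') (φ z') ∂(P z)

theorem measurable_bellman [IsMarkovKernel P] (hr : Measurable r) (hc : Measurable c)
    (hφ : Measurable φ) : Measurable (bellman P β r c φ) :=
  hc.add ((hr.max hφ).stronglyMeasurable.integral_kernel.measurable.const_mul β)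

theorem mem_weightedBounded (hℓ0 : ∀ z, 0 < ℓ z) (hφ : Measurable φ)
    (hK : ∀ z, |φ z| ≤ K * ℓ z) : φ ∈ weightedBounded ℓ := by
  refine ⟨hφ, K, ?_⟩
  rintro _ ⟨z, rfl⟩
  exact (div_le_iff₀ (hℓ0 z)).2 (hK z)

theorem integrable_of_abs_le_weight {μ : Measure Z} (hℓi : Integrable ℓ μ) (hφ : Measurable φ)
    (hK : ∀ z, |φ z| ≤ K * ℓ z) : Integrable φ μ :=
  (hℓi.const_mul K).mono' hφ.aestronglyMeasurable (ae_of_all _ hK)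

/-- `max (r y) ·` is 1-Lipschitz, integrating `ℓ` costs a factor `a`, and discounting gives `β`. -/
theorem abs_bellman_sub_le (hβ : 0 ≤ β) (hℓi : ∀ z, Integrable ℓ (P z))
    (hℓP : ∀ z, ∫ y, ℓ y ∂(P z) ≤ a * ℓ z) (hri : ∀ z, Integrable r (P z))
    (hφ : ∀ z, Integrable φ (P z)) (hφ' : ∀ z, Integrable φ' (P z)) {D : ℝ} (hD : 0 ≤ D)
    (h : ∀ z, |φ z - φ' z| ≤ D * ℓ z) (z : Z) :
    |bellman P β r c φ z - bellman P β r c φ' z| ≤ β * a * D * ℓ z := by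
  have h1 : Integrable (fun y => max (r y) (φ y)) (P z) := (hri z).sup (hφ z)
  have h2 : Integrable (fun y => max (r y) (φ' y)) (P z) := (hri z).sup (hφ' z)
  have h3 : |∫ y, (max (r y) (φ y) - max (r y) (φ' y)) ∂(P z)| ≤ D * (a * ℓ z) := by
    refine (abs_integral_le_integral_abs).trans ?_
    calc ∫ y, |max (r y) (φ y) - max (r y) (φ' y)| ∂(P z)
        ≤ ∫ y, D * ℓ y ∂(P z) := by
          refine integral_mono (h1.sub h2).abs ((hℓi z).const_mul D) fun y => ?_
          refine (abs_max_sub_max_le_max _ _ _ _).trans ?_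
          rw [sub_self, abs_zero, max_eq_right (abs_nonneg _)]
          exact h y
      _ ≤ D * (a * ℓ z) := by
          rw [integral_const_mul]
          exact mul_le_mul_of_nonneg_left (hℓP z) hD
  have h4 : bellman P β r c φ z - bellman P β r c φ' z
      = β * ∫ y, (max (r y) (φ y) - max (r y) (φ' y)) ∂(P z) := by
    rw [integral_sub h1 h2]
    simp only [bellman]
    ring
  rw [h4, abs_mul, abs_of_nonneg hβ]
  exact (mul_le_mul_of_nonneg_left h3 hβ).trans_eq (by ring)

/-- Value iteration for the Bellman operator converges to a solution of the Bellman equation. -/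
theorem exists_bellman_solution [IsMarkovKernel P] (hβ : 0 ≤ β) (ha : 0 ≤ a) (hβa : β * a < 1)
    (hℓ0 : ∀ z, 0 < ℓ z) (hℓi : ∀ z, Integrable ℓ (P z))
    (hℓP : ∀ z, ∫ y, ℓ y ∂(P z) ≤ a * ℓ z) (hr : Measurable r) (hc : Measurable c)
    (hK : 0 ≤ K) (hcK : ∀ z, |c z| ≤ K * ℓ z) (hri : ∀ z, Integrable r (P z))
    (hrK : ∀ z, ∫ y, |r y| ∂(P z) ≤ K * ℓ z) :
    ∃ (ψ : Z → ℝ) (B : ℝ), Measurable ψ ∧ 0 ≤ B ∧ (∀ z, |ψ z| ≤ B * ℓ z) ∧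
      bellman P β r c ψ = ψ ∧ (∀ k, (bellman P β r c)^[k] 0 ∈ weightedBounded ℓ) ∧
      ∀ z, Tendsto (fun k => (bellman P β r c)^[k] 0 z) atTop (𝓝 (ψ z)) := by
  set Q := bellman P β r c with hQ
  set u : ℕ → Z → ℝ := fun k => Q^[k] 0 with hu
  have hus : ∀ k, u (k + 1) = Q (u k) := fun k => Function.iterate_succ_apply' Q k 0
  set κ := β * a with hκ
  have hκ0 : 0 ≤ κ := mul_nonneg hβ ha
  have hκ1 : 0 < 1 - κ := sub_pos.2 hβa
  -- `D` bounds `Q 0` relative to `ℓ`. `B` solves `κ * B + D = B`, so the bound `B * ℓ` passes from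
  -- each iterate to the next; it is also the sum of the geometric series of step sizes.
  set D := K + β * K with hDdef
  have hD : 0 ≤ D := by positivity
  set B := D / (1 - κ) with hBdef
  have hB : 0 ≤ B := div_nonneg hD hκ1.le
  have hBD : κ * B + D = B := by
    rw [hBdef]
    field_simp
    ring
  have hum : ∀ k, Measurable (u k) := by
    intro k
    induction k with
    | zero => exact measurable_const
    | succ k ih =>
      rw [hus]
      exact measurable_bellman hr hc ih
  have hQ0 : ∀ z, |Q 0 z| ≤ D * ℓ z := by
    intro z
    have h1 : |∫ y, max (r y) 0 ∂(P z)| ≤ K * ℓ z := by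
      refine abs_integral_le_integral_abs.trans (le_trans ?_ (hrK z))
      refine integral_mono ((hri z).sup (integrable_zero _ _ _)).abs (hri z).abs fun y => ?_
      refine abs_max_le_max_abs_abs.trans ?_
      simp
    calc |Q 0 z| ≤ |c z| + |β * ∫ y, max (r y) 0 ∂(P z)| := abs_add_le _ _
      _ ≤ K * ℓ z + β * (K * ℓ z) := by
          rw [abs_mul, abs_of_nonneg hβ]
          exact add_le_add (hcK z) (mul_le_mul_of_nonneg_left h1 hβ)
      _ = D * ℓ z := by rw [hDdef]; ring
  have huB : ∀ k z, |u k z| ≤ B * ℓ z := by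
    intro k
    induction k with
    | zero =>
      intro z
      simpa [hu] using mul_nonneg hB (hℓ0 z).le
    | succ k ih =>
      intro z
      have h1 : |Q (u k) z - Q 0 z| ≤ κ * B * ℓ z :=
        abs_bellman_sub_le hβ hℓi hℓP hri (fun z => integrable_of_abs_le_weight (hℓi z) (hum k) ih)
          (fun z => integrable_zero _ _ _) hB (by simpa using ih) z
      rw [hus]
      calc |Q (u k) z| = |(Q (u k) z - Q 0 z) + Q 0 z| := by rw [sub_add_cancel]
        _ ≤ κ * B * ℓ z + D * ℓ z := (abs_add_le _ _).trans (add_le_add h1 (hQ0 z))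
        _ = B * ℓ z := by rw [← add_mul, hBD]
  have hui : ∀ k z, Integrable (u k) (P z) := fun k z =>
    integrable_of_abs_le_weight (hℓi z) (hum k) (huB k)
  have hstep : ∀ k z, |u k z - u (k + 1) z| ≤ D * κ ^ k * ℓ z := by
    intro k
    induction k with
    | zero =>
      intro z
      have : u 0 z - u 1 z = -Q 0 z := by simp [hu]
      rw [zero_add, this, abs_neg, pow_zero, mul_one]
      exact hQ0 z
    | succ k ih =>
      intro z
      rw [hus, hus (k + 1)]
      refine (abs_bellman_sub_le hβ hℓi hℓP hri (hui k) (hui (k + 1)) (by positivity) ih z).trans_eq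
        ?_
      rw [← hκ]
      ring
  have hdist : ∀ z k, dist (u k z) (u (k + 1) z) ≤ D * ℓ z * κ ^ k := fun z k => by
    rw [Real.dist_eq]
    exact (hstep k z).trans_eq (by ring)
  have hlim : ∀ z, ∃ x, Tendsto (fun k => u k z) atTop (𝓝 x) := fun z =>
    cauchySeq_tendsto_of_complete (cauchySeq_of_le_geometric κ (D * ℓ z) hβa (hdist z))
  choose ψ hψ using hlim
  have hψm : Measurable ψ := measurable_of_tendsto_metrizable hum (tendsto_pi_nhds.2 hψ)
  have hψB : ∀ z, |ψ z| ≤ B * ℓ z := fun z => le_of_tendsto' (hψ z).abs fun k => huB k z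
  have herr : ∀ k z, |u k z - ψ z| ≤ B * κ ^ k * ℓ z := fun k z => by
    have := dist_le_of_le_geometric_of_tendsto κ (D * ℓ z) hβa (hdist z) (hψ z) k
    rw [Real.dist_eq] at this
    refine this.trans_eq ?_
    rw [hBdef]
    ring
  refine ⟨ψ, B, hψm, hB, hψB, ?_, fun k => mem_weightedBounded hℓ0 (hum k) (huB k), hψ⟩
  funext z
  -- Contraction applied to `u k` and `ψ`: the shifted sequence also tends to `Q ψ`, and uniqueness
  -- of limits gives the fixed point.
  have h1 : ∀ k, |u (k + 1) z - Q ψ z| ≤ κ * (B * κ ^ k) * ℓ z := fun k => by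
    rw [hus]
    exact abs_bellman_sub_le hβ hℓi hℓP hri (hui k)
      (fun z => integrable_of_abs_le_weight (hℓi z) hψm hψB) (by positivity) (herr k) z
  have h2 : Tendsto (fun k => κ * (B * κ ^ k) * ℓ z) atTop (𝓝 0) := by
    have := (((tendsto_pow_atTop_nhds_zero_of_lt_one hκ0 hβa).const_mul B).const_mul κ).mul_const
      (ℓ z)
    simpa using this
  have h3 : Tendsto (fun k => u (k + 1) z) atTop (𝓝 (Q ψ z)) := by
    rw [tendsto_iff_dist_tendsto_zero]
    exact squeeze_zero (fun _ => dist_nonneg) h1 h2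
  exact tendsto_nhds_unique h3 ((tendsto_add_atTop_iff_nat 1).2 (hψ z))

end Bellman

/-! ### Drift and domination properties of the weight. -/

section Weight

variable {Z : Type*} [MeasurableSpace Z] {P : Kernel Z Z} {β : ℝ} {r c g f : Z → ℝ} {n : ℕ}
  {m d m' d' : ℝ}

theorem lintegral_lintegral_pow (P : Kernel Z Z) {f : Z → ℝ≥0∞} (hf : Measurable f) (t : ℕ)
    (z : Z) : ∫⁻ y, ∫⁻ x, f x ∂((P ^ t) y) ∂(P z) = ∫⁻ x, f x ∂((P ^ (t + 1)) z) := by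
  rw [Kernel.pow_add, pow_one, Kernel.lintegral_comp _ _ _ hf]

theorem lintegral_pow_zero (P : Kernel Z Z) {f : Z → ℝ≥0∞} (hf : Measurable f) (z : Z) :
    ∫⁻ x, f x ∂((P ^ 0) z) = f z := by
  have h : P ^ 0 = Kernel.id := pow_zero P
  rw [h, Kernel.lintegral_id' hf]

theorem integrable_of_lintegral_abs_le {μ : Measure Z} (hf : Measurable f) {b : ℝ}
    (h : ∫⁻ x, ENNReal.ofReal |f x| ∂μ ≤ ENNReal.ofReal b) : Integrable f μ := by
  refine ⟨hf.aestronglyMeasurable, ?_⟩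
  rw [hasFiniteIntegral_iff_norm]
  exact h.trans_lt ENNReal.ofReal_lt_top

theorem integral_le_of_lintegral_le {μ : Measure Z} (hf : Measurable f) (hf0 : ∀ x, 0 ≤ f x)
    {b : ℝ} (hb : 0 ≤ b) (h : ∫⁻ x, ENNReal.ofReal (f x) ∂μ ≤ ENNReal.ofReal b) :
    ∫ x, f x ∂μ ≤ b := by
  rw [integral_eq_lintegral_of_nonneg_ae (ae_of_all _ hf0) hf.aestronglyMeasurable]
  exact ENNReal.toReal_le_of_le_ofReal hb h

theorem ofReal_integral_abs {μ : Measure Z} (h : Integrable f μ) :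
    ENNReal.ofReal (∫ x, |f x| ∂μ) = ∫⁻ x, ENNReal.ofReal |f x| ∂μ :=
  ofReal_integral_eq_lintegral_ofReal h.abs (ae_of_all _ fun _ => abs_nonneg _)

/-- Integrating against `P` turns `t`-step expectations into `(t + 1)`-step ones. The only new term
is the `n`-step one, which the drift assumption bounds by `g`. -/
theorem sum_Ico_one_succ_le (L : ℕ → ℝ≥0∞) (n : ℕ) :
    ∑ t ∈ Finset.Ico 1 n, L (t + 1) ≤ ∑ t ∈ Finset.Ico 1 n, L t + L n := by
  rcases Nat.eq_zero_or_pos n with rfl | hn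
  · simp
  · rw [← Finset.sum_Ico_succ_top hn, Finset.sum_Ico_add' L 1 n 1]
    exact Finset.sum_le_sum_of_subset (Finset.Ico_subset_Ico_left (by omega))

theorem sum_range_succ_le (L : ℕ → ℝ≥0∞) (n : ℕ) :
    ∑ t ∈ Finset.range n, L (t + 1) ≤ ∑ t ∈ Finset.range n, L t + L n := by
  rw [← Finset.sum_range_succ, Finset.sum_range_succ']
  exact le_self_add

theorem measurable_weight [IsMarkovKernel P] (hr : Measurable r) (hc : Measurable c)
    (hg : Measurable g) : Measurable (weight P r c g n m' d') := by
  have h : ∀ {f : Z → ℝ}, Measurable f → ∀ t, Measurable fun z => ∫ y, |f y| ∂((P ^ t) z) :=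
    fun hf t =>
      (continuous_abs.measurable.comp hf).stronglyMeasurable.integral_kernel.measurable
  exact ((((Finset.measurable_fun_sum _ fun t _ => h hr t).add
    (Finset.measurable_fun_sum _ fun t _ => h hc t)).const_mul m').add hg).add_const d'

theorem add_le_weight (hm' : 0 ≤ m') (hg : ∀ z, 0 ≤ g z) (hd' : 0 ≤ d') (z : Z) :
    g z ≤ weight P r c g n m' d' z ∧ d' ≤ weight P r c g n m' d' z ∧
      (∀ t ∈ Finset.Ico 1 n, m' * ∫ y, |r y| ∂((P ^ t) z) ≤ weight P r c g n m' d' z) ∧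
      ∀ t ∈ Finset.range n, m' * ∫ y, |c y| ∂((P ^ t) z) ≤ weight P r c g n m' d' z := by
  have hn : ∀ (f : Z → ℝ) t, 0 ≤ ∫ y, |f y| ∂((P ^ t) z) := fun f t =>
    integral_nonneg fun _ => abs_nonneg _
  have h1 := mul_nonneg hm' (Finset.sum_nonneg fun t (_ : t ∈ Finset.Ico 1 n) => hn r t)
  have h2 := mul_nonneg hm' (Finset.sum_nonneg fun t (_ : t ∈ Finset.range n) => hn c t)
  have h3 := hg z
  simp only [weight, mul_add]
  refine ⟨by linarith, by linarith, fun t ht => ?_, fun t ht => ?_⟩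
  · have := mul_le_mul_of_nonneg_left
      (Finset.single_le_sum (f := fun t => ∫ y, |r y| ∂((P ^ t) z)) (fun t _ => hn r t) ht) hm'
    linarith
  · have := mul_le_mul_of_nonneg_left
      (Finset.single_le_sum (f := fun t => ∫ y, |c y| ∂((P ^ t) z)) (fun t _ => hn c t) ht) hm'
    linarith

theorem integrable_pow_zero (hf : Measurable f) (z : Z) : Integrable f ((P ^ 0) z) :=
  integrable_of_lintegral_abs_le hf
    (lintegral_pow_zero P (continuous_abs.measurable.comp hf).ennreal_ofReal z).le

/-- The weight satisfies a multiplicative drift inequality. -/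
theorem DriftCondition.lintegral_weight_le [IsMarkovKernel P]
    (hD : DriftCondition P β r c g n m d) (hr : Measurable r) (hc : Measurable c)
    (hfin : ∀ z, ∀ t ∈ Finset.Ico 1 n, Integrable r ((P ^ t) z) ∧ Integrable c ((P ^ t) z))
    (hm' : 0 < m') (hd' : 0 < d') (hm1 : 1 < m + 2 * m') (hdd : d / (m + 2 * m' - 1) ≤ d')
    (z : Z) :
    ∫⁻ y, ENNReal.ofReal (weight P r c g n m' d' y) ∂(P z)
      ≤ ENNReal.ofReal ((m + 2 * m') * weight P r c g n m' d' z) := by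
  set Lr : ℕ → Z → ℝ≥0∞ := fun t y => ∫⁻ x, ENNReal.ofReal |r x| ∂((P ^ t) y) with hLr
  set Lc : ℕ → Z → ℝ≥0∞ := fun t y => ∫⁻ x, ENNReal.ofReal |c x| ∂((P ^ t) y) with hLc
  have har : Measurable fun x => ENNReal.ofReal |r x| :=
    (continuous_abs.measurable.comp hr).ennreal_ofReal
  have hac : Measurable fun x => ENNReal.ofReal |c x| :=
    (continuous_abs.measurable.comp hc).ennreal_ofReal
  have hmr : ∀ t, Measurable (Lr t) := fun t => har.lintegral_kernel
  have hmc : ∀ t, Measurable (Lc t) := fun t => hac.lintegral_kernel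
  have hn : ∀ (f : Z → ℝ) t y, 0 ≤ ∫ x, |f x| ∂((P ^ t) y) := fun f t y =>
    integral_nonneg fun _ => abs_nonneg _
  set s : Z → ℝ := fun y => ∑ t ∈ Finset.Ico 1 n, ∫ z', |r z'| ∂((P ^ t) y)
      + ∑ t ∈ Finset.range n, ∫ z', |c z'| ∂((P ^ t) y) with hs
  have hs0 : ∀ y, 0 ≤ s y := fun y => add_nonneg (Finset.sum_nonneg fun t _ => hn r t y)
    (Finset.sum_nonneg fun t _ => hn c t y)
  have hofs : ∀ y, ENNReal.ofReal (s y)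
      = ∑ t ∈ Finset.Ico 1 n, Lr t y + ∑ t ∈ Finset.range n, Lc t y := by
    intro y
    rw [hs, ENNReal.ofReal_add (Finset.sum_nonneg fun t _ => hn r t y)
      (Finset.sum_nonneg fun t _ => hn c t y), ENNReal.ofReal_sum_of_nonneg fun t _ => hn r t y,
      ENNReal.ofReal_sum_of_nonneg fun t _ => hn c t y]
    congr 1
    · exact Finset.sum_congr rfl fun t ht => ofReal_integral_abs (hfin y t ht).1
    · refine Finset.sum_congr rfl fun t ht => ofReal_integral_abs ?_
      rcases Nat.eq_zero_or_pos t with rfl | h0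
      · exact integrable_pow_zero hc y
      · exact (hfin y t (Finset.mem_Ico.2 ⟨h0, Finset.mem_range.1 ht⟩)).2
  have hw : ∀ y, ENNReal.ofReal (weight P r c g n m' d' y)
      = ENNReal.ofReal m' * (∑ t ∈ Finset.Ico 1 n, Lr t y + ∑ t ∈ Finset.range n, Lc t y)
        + ENNReal.ofReal (g y) + ENNReal.ofReal d' := by
    intro y
    have h1 : 0 ≤ m' * s y := mul_nonneg hm'.le (hs0 y)
    change ENNReal.ofReal (m' * s y + g y + d') = _
    rw [ENNReal.ofReal_add (add_nonneg h1 (hD.g_nonneg y)) hd'.le,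
      ENNReal.ofReal_add h1 (hD.g_nonneg y), ENNReal.ofReal_mul hm'.le, hofs]
  have hsr : ∑ t ∈ Finset.Ico 1 n, Lr (t + 1) z
      ≤ ∑ t ∈ Finset.Ico 1 n, Lr t z + ENNReal.ofReal (g z) :=
    (sum_Ico_one_succ_le (fun t => Lr t z) n).trans (add_le_add_right (hD.bound_r z) _)
  have hsc : ∑ t ∈ Finset.range n, Lc (t + 1) z
      ≤ ∑ t ∈ Finset.range n, Lc t z + ENNReal.ofReal (g z) :=
    (sum_range_succ_le (fun t => Lc t z) n).trans (add_le_add_right (hD.bound_c z) _)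
  have hmsr : Measurable fun y => ∑ t ∈ Finset.Ico 1 n, Lr t y :=
    Finset.measurable_fun_sum _ fun t _ => hmr t
  have hmsc : Measurable fun y => ∑ t ∈ Finset.range n, Lc t y :=
    Finset.measurable_fun_sum _ fun t _ => hmc t
  have hmsrc : Measurable fun y => ∑ t ∈ Finset.Ico 1 n, Lr t y + ∑ t ∈ Finset.range n, Lc t y :=
    hmsr.add hmsc
  have hint : ∫⁻ y, ENNReal.ofReal (weight P r c g n m' d' y) ∂(P z)
      = ENNReal.ofReal m' * (∑ t ∈ Finset.Ico 1 n, Lr (t + 1) z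
          + ∑ t ∈ Finset.range n, Lc (t + 1) z)
        + ∫⁻ y, ENNReal.ofReal (g y) ∂(P z) + ENNReal.ofReal d' := by
    simp_rw [hw]
    rw [lintegral_add_right _ measurable_const, lintegral_const, measure_univ, mul_one,
      lintegral_add_right _ hD.measurable_g.ennreal_ofReal,
      lintegral_const_mul _ hmsrc, lintegral_add_left hmsr,
      lintegral_finsetSum _ fun t _ => hmr t, lintegral_finsetSum _ fun t _ => hmc t]
    simp only [hLr, hLc, lintegral_lintegral_pow P har, lintegral_lintegral_pow P hac]
  have hg0 := hD.g_nonneg z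
  have hm0 := hD.m_nonneg
  have hd0 := hD.d_nonneg
  have hs0z := hs0 z
  calc ∫⁻ y, ENNReal.ofReal (weight P r c g n m' d' y) ∂(P z)
      ≤ ENNReal.ofReal m' * ((∑ t ∈ Finset.Ico 1 n, Lr t z + ENNReal.ofReal (g z))
          + (∑ t ∈ Finset.range n, Lc t z + ENNReal.ofReal (g z)))
        + ENNReal.ofReal (m * g z + d) + ENNReal.ofReal d' := by
        rw [hint]
        gcongr
        exact hD.drift z
    _ = ENNReal.ofReal (m' * (s z + (g z + g z)) + (m * g z + d) + d') := by
        rw [add_add_add_comm, ← hofs, ← ENNReal.ofReal_add hg0 hg0,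
          ← ENNReal.ofReal_add hs0z (by positivity), ← ENNReal.ofReal_mul hm'.le,
          ← ENNReal.ofReal_add (by positivity) (by positivity),
          ← ENNReal.ofReal_add (by positivity) hd'.le]
    _ ≤ ENNReal.ofReal ((m + 2 * m') * weight P r c g n m' d' z) := by
        -- The two new terms, from `r` and `c`, add `2 * m' * g z` to `m * g z`, whence the factor
        -- `m + 2 * m'`. The old sums are absorbed because this factor exceeds `1`, and `d + d'` by
        -- the choice of `d'`.
        refine ENNReal.ofReal_le_ofReal ?_
        change _ ≤ (m + 2 * m') * (m' * s z + g z + d')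
        have h1 : d ≤ d' * (m + 2 * m' - 1) := (div_le_iff₀ (by linarith)).1 hdd
        have h2 : 0 ≤ (m + 2 * m' - 1) * (m' * s z) :=
          mul_nonneg (by linarith) (by positivity)
        linarith

/-- The running payoff and the one-step expectation of the exit payoff are dominated by the
weight. -/
theorem DriftCondition.exists_weight_bound [IsMarkovKernel P]
    (hD : DriftCondition P β r c g n m d) (hr : Measurable r) (hc : Measurable c)
    (hfin : ∀ z, ∀ t ∈ Finset.Ico 1 n, Integrable r ((P ^ t) z) ∧ Integrable c ((P ^ t) z))
    (hm' : 0 < m') (hd' : 0 < d') (hm1 : 1 < m + 2 * m') (hdd : d / (m + 2 * m' - 1) ≤ d') :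
    ∃ K, 0 ≤ K ∧ (∀ z, |c z| ≤ K * weight P r c g n m' d' z) ∧
      ∀ z, ∫⁻ y, ENNReal.ofReal |r y| ∂(P z) ≤ ENNReal.ofReal (K * weight P r c g n m' d' z) := by
  have hw : ∀ z, _ := fun z =>
    add_le_weight (P := P) (r := r) (c := c) (n := n) hm'.le hD.g_nonneg hd'.le z
  have har : Measurable fun x => ENNReal.ofReal |r x| :=
    (continuous_abs.measurable.comp hr).ennreal_ofReal
  have hac : Measurable fun x => ENNReal.ofReal |c x| :=
    (continuous_abs.measurable.comp hc).ennreal_ofReal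
  set ℓ := weight P r c g n m' d' with hℓ
  have hℓ0 : ∀ z, 0 ≤ ℓ z := fun z => hd'.le.trans (hw z).2.1
  have hK : ∀ {k : ℝ}, k ≤ 1 + 1 / m' + (m + 2 * m') → ∀ z,
      k * ℓ z ≤ (1 + 1 / m' + (m + 2 * m')) * ℓ z := fun hk z =>
    mul_le_mul_of_nonneg_right hk (hℓ0 z)
  have hinv : 0 < 1 / m' := by positivity
  have hK1 : ∀ z, ℓ z ≤ (1 + 1 / m' + (m + 2 * m')) * ℓ z := fun z => by
    simpa using hK (k := 1) (by linarith) z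
  have hKm : ∀ x z, m' * x ≤ ℓ z → x ≤ (1 + 1 / m' + (m + 2 * m')) * ℓ z := fun x z h => by
    refine le_trans ?_ (hK (k := 1 / m') (by linarith) z)
    rw [one_div, ← div_eq_inv_mul, le_div_iff₀ hm', mul_comm]
    exact h
  -- The constant majorizes all cases: `1` for a bound through `g`, `1 / m'` for a summand of the
  -- weight, and `m + 2 * m'` for `|r| ≤ ℓ` integrated once when `n = 0`.
  refine ⟨1 + 1 / m' + (m + 2 * m'), by linarith, fun z => ?_, fun z => ?_⟩
  · rcases Nat.eq_zero_or_pos n with rfl | hn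
    · have h := hD.bound_c z
      rw [lintegral_pow_zero P hac, ENNReal.ofReal_le_ofReal_iff (hD.g_nonneg z)] at h
      exact h.trans ((hw z).1.trans (hK1 z))
    · have h := (hw z).2.2.2 0 (Finset.mem_range.2 hn)
      have h0 : ∫ y, |c y| ∂((P ^ 0) z) = |c z| := by
        rw [← ENNReal.ofReal_eq_ofReal_iff (integral_nonneg fun _ => abs_nonneg _)
          (abs_nonneg _), ofReal_integral_abs (integrable_pow_zero hc z),
          lintegral_pow_zero P hac]
      rw [h0] at h
      exact hKm _ z h
  -- The one-step expectation of `|r|` is a summand of the weight only for `n ≥ 2`; for `n = 1` it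
  -- is bounded by `g` directly.
  · rcases lt_trichotomy n 1 with hn | rfl | hn
    · obtain rfl : n = 0 := by omega
      have h : ∀ y, |r y| ≤ ℓ y := fun y => by
        have h := hD.bound_r y
        rw [lintegral_pow_zero P har, ENNReal.ofReal_le_ofReal_iff (hD.g_nonneg y)] at h
        exact h.trans (hw y).1
      refine (lintegral_mono fun y => ENNReal.ofReal_le_ofReal (h y)).trans
        ((hD.lintegral_weight_le hr hc hfin hm' hd' hm1 hdd z).trans
          (ENNReal.ofReal_le_ofReal (hK (by linarith) z)))
    · have h := hD.bound_r z
      rw [pow_one] at h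
      exact h.trans (ENNReal.ofReal_le_ofReal ((hw z).1.trans (hK1 z)))
    · have h1 : 1 ∈ Finset.Ico 1 n := Finset.mem_Ico.2 ⟨le_rfl, hn⟩
      have h := (hw z).2.2.1 1 h1
      have hi := (hfin z 1 h1).1
      rw [pow_one] at h hi
      rw [← ofReal_integral_abs hi]
      exact ENNReal.ofReal_le_ofReal (hKm _ z h)

end Weight

/-! ### Monotonicity of the Bellman solution. -/

section Monotonicity

variable {Z : Type*} [MeasurableSpace Z] [Preorder Z] {P : Kernel Z Z} {β : ℝ} {r c ℓ ψ : Z → ℝ}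

/-- Monotonicity passes from the Bellman iterates to their limit. -/
theorem monotone_of_tendsto_bellman (hβ : 0 ≤ β) (hc : Monotone c)
    (h : ∀ φ ∈ weightedBounded ℓ, Monotone φ → Monotone fun z => ∫ z', max (r z') (φ z') ∂(P z))
    (hmem : ∀ k, (bellman P β r c)^[k] 0 ∈ weightedBounded ℓ)
    (hlim : ∀ z, Tendsto (fun k => (bellman P β r c)^[k] 0 z) atTop (𝓝 (ψ z))) : Monotone ψ := by
  have hk : ∀ k, Monotone ((bellman P β r c)^[k] 0) := by
    intro k
    induction k with
    | zero => exact monotone_const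
    | succ k ih =>
      rw [Function.iterate_succ_apply']
      exact hc.add ((h _ (hmem k) ih).const_mul hβ)
  exact fun x y hxy => le_of_tendsto_of_tendsto' (hlim x) (hlim y) fun k => hk k hxy

theorem antitone_of_tendsto_bellman (hβ : 0 ≤ β) (hc : Antitone c)
    (h : ∀ φ ∈ weightedBounded ℓ, Antitone φ → Antitone fun z => ∫ z', max (r z') (φ z') ∂(P z))
    (hmem : ∀ k, (bellman P β r c)^[k] 0 ∈ weightedBounded ℓ)
    (hlim : ∀ z, Tendsto (fun k => (bellman P β r c)^[k] 0 z) atTop (𝓝 (ψ z))) : Antitone ψ := by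
  have hk : ∀ k, Antitone ((bellman P β r c)^[k] 0) := by
    intro k
    induction k with
    | zero => exact antitone_const
    | succ k ih =>
      rw [Function.iterate_succ_apply']
      exact hc.add ((h _ (hmem k) ih).const_mul hβ)
  exact fun x y hxy => le_of_tendsto_of_tendsto' (hlim y) (hlim x) fun k => hk k hxy

end Monotonicity

end OptStop

/-! ### The main theorem. -/

theorem mainTheorem5 {Ω Z : Type*} {mΩ : MeasurableSpace Ω} [MeasurableSpace Z] [Preorder Z]
    (P : Kernel Z Z) [IsMarkovKernel P]
    (F : Filtration ℕ mΩ) (Pr : Z → Measure Ω) (X : ℕ → Ω → Z)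
    (hX : OptStop.IsMarkovFamily P F Pr X)
    (β : ℝ) (hβ0 : 0 < β) (hβ1 : β < 1)
    (r c : Z → ℝ) (hr : Measurable r) (hc : Measurable c)
    (g : Z → ℝ) (n : ℕ) (m d : ℝ)
    (hdrift : OptStop.DriftCondition P β r c g n m d)
    (hfin : ∀ z, ∀ t ∈ Finset.Ico 1 n,
      Integrable r ((P ^ t) z) ∧ Integrable c ((P ^ t) z))
    (m' d' : ℝ) (hm' : 0 < m') (hd' : 0 < d') (hm1 : 1 < m + 2 * m')
    (hβm : β * (m + 2 * m') < 1) (hdd : d / (m + 2 * m' - 1) ≤ d') :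
    -- `v*` and `ψ*` are well defined and finite
    ((∀ z, ∀ τ ∈ OptStop.finiteStoppingTimes F Pr,
        Integrable (OptStop.payoff β r c X τ) (Pr z)) ∧
      (∀ z, BddAbove (Set.range fun τ : OptStop.finiteStoppingTimes F Pr =>
        ∫ ω, OptStop.payoff β r c X τ ω ∂(Pr z))) ∧
      (∀ z, Integrable (OptStop.value β r c F Pr X) (P z))) ∧
    -- the increasing case
    (Monotone c →
      (∀ ψ ∈ OptStop.weightedBounded (OptStop.weight P r c g n m' d'), Monotone ψ →
        Monotone fun z => ∫ z', max (r z') (ψ z') ∂(P z)) →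
      Monotone (OptStop.contValue P β r c F Pr X) ∧
        (Monotone r → Monotone (OptStop.value β r c F Pr X))) ∧
    -- the decreasing case
    (Antitone c →
      (∀ ψ ∈ OptStop.weightedBounded (OptStop.weight P r c g n m' d'), Antitone ψ →
        Antitone fun z => ∫ z', max (r z') (ψ z') ∂(P z)) →
      Antitone (OptStop.contValue P β r c F Pr X) ∧
        (Antitone r → Antitone (OptStop.value β r c F Pr X))) := by
  have hℓ0 : ∀ z, 0 < OptStop.weight P r c g n m' d' z := fun z =>
    hd'.trans_le (OptStop.add_le_weight hm'.le hdrift.g_nonneg hd'.le z).2.1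
  have hℓm : Measurable (OptStop.weight P r c g n m' d') :=
    OptStop.measurable_weight hr hc hdrift.measurable_g
  have hℓP := hdrift.lintegral_weight_le hr hc hfin hm' hd' hm1 hdd
  obtain ⟨K, hK, hcK, hrK⟩ := hdrift.exists_weight_bound hr hc hfin hm' hd' hm1 hdd
  set ℓ := OptStop.weight P r c g n m' d'
  set a := m + 2 * m'
  have ha : 0 ≤ a := by linarith
  have hℓi : ∀ z, Integrable ℓ (P z) := fun z =>
    OptStop.integrable_of_lintegral_abs_le hℓm (b := a * ℓ z) (by
      simpa only [fun y => abs_of_pos (hℓ0 y)] using hℓP z)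
  have hri : ∀ z, Integrable r (P z) := fun z => OptStop.integrable_of_lintegral_abs_le hr (hrK z)
  obtain ⟨ψ, B, hψm, hB, hψB, hψ, hmem, hlim⟩ := OptStop.exists_bellman_solution (P := P)
    hβ0.le ha hβm hℓ0 hℓi
    (fun z => OptStop.integral_le_of_lintegral_le hℓm (fun y => (hℓ0 y).le)
      (mul_nonneg ha (hℓ0 z).le) (hℓP z)) hr hc hK hcK hri
    (fun z => OptStop.integral_le_of_lintegral_le (continuous_abs.measurable.comp hr)
      (fun y => abs_nonneg _) (mul_nonneg hK (hℓ0 z).le) (hrK z))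
  -- Turns the pointwise bounds on `c` and `ψ` into the one-step form that `r` already satisfies, so
  -- that one summability lemma handles all three.
  have hdom : ∀ {f : Z → ℝ} {C : ℝ}, 0 ≤ C → (∀ z, |f z| ≤ C * ℓ z) → ∀ z,
      ∫⁻ y, ENNReal.ofReal |f y| ∂(P z) ≤ ENNReal.ofReal (C * a * ℓ z) := fun {f C} hC hf z => by
    calc ∫⁻ y, ENNReal.ofReal |f y| ∂(P z)
        ≤ ∫⁻ y, ENNReal.ofReal C * ENNReal.ofReal (ℓ y) ∂(P z) := lintegral_mono fun y =>
          (ENNReal.ofReal_le_ofReal (hf y)).trans_eq (ENNReal.ofReal_mul hC)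
      _ = ENNReal.ofReal C * ∫⁻ y, ENNReal.ofReal (ℓ y) ∂(P z) :=
          lintegral_const_mul _ hℓm.ennreal_ofReal
      _ ≤ ENNReal.ofReal C * ENNReal.ofReal (a * ℓ z) := mul_le_mul_right (hℓP z) _
      _ = ENNReal.ofReal (C * a * ℓ z) := by rw [← ENNReal.ofReal_mul hC, mul_assoc]
  have hrS := hX.lintegral_tsum_ne_top hβ0.le ha hβm hℓm hℓP hr hK hrK
  have hcS := hX.lintegral_tsum_ne_top hβ0.le ha hβm hℓm hℓP hc (mul_nonneg hK ha) (hdom hK hcK)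
  have hψS := hX.lintegral_tsum_ne_top hβ0.le ha hβm hℓm hℓP hψm (mul_nonneg hB ha) (hdom hB hψB)
  have hvalue : OptStop.value β r c F Pr X = fun z => max (r z) (ψ z) := funext fun z =>
    hX.value_eq hβ0 hr hc hψm (hrS z) (hcS z) (hψS z) fun y => (congrFun hψ y).symm
  have hcont : OptStop.contValue P β r c F Pr X = ψ := by
    funext z
    rw [OptStop.contValue, hvalue]
    exact congrFun hψ z
  rw [hcont, hvalue]
  refine ⟨⟨fun z τ hτ =>
      OptStop.integrable_payoff hβ0.le hX.measurable hr hc hτ.1 (hrS z) (hcS z),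
    fun z => OptStop.bddAbove_integral_payoff hβ0.le hX.measurable hr hc (hrS z) (hcS z),
    fun z => (hri z).sup (OptStop.integrable_of_abs_le_weight (hℓi z) hψm hψB)⟩,
    fun hcmono h => ?_, fun hcanti h => ?_⟩
  · have hψmono := OptStop.monotone_of_tendsto_bellman hβ0.le hcmono h hmem hlim
    exact ⟨hψmono, fun hrmono => hrmono.max hψmono⟩
  · have hψanti := OptStop.antitone_of_tendsto_bellman hβ0.le hcanti h hmem hlim
    exact ⟨hψanti, fun hranti => hranti.max hψanti⟩
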